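/- Let $A$ be a commutative unital $\mathbb{R}$-algebra and $d\ge 1$ an integer. Let $\sum A^{2d}$ denote the set of all finite sums of $2d$-th powers of elements of $A$. A $\sum A^{2d}$-module of $A$ is a subset $S\subseteq A$ with $1\in S$, $S+S\subseteq S$, and $a^{2d}S\subseteq S$ for every $a\in A$. Let $V_A$ be the set of all unital $\mathbb{R}$-algebra homomorphisms $A\to\mathbb{R}$. For $S\subseteq A$ put $K_S=\{\alpha\in V_A:\alpha(a)\ge 0\text{ for all }a\in S\}$, and for $K\subseteq V_A$ put $\mathrm{Pos}(K)=\{a\in A:\alpha(a)\ge 0\text{ for all }\alpha\in K\}$. A seminorm $\rho$ on the real vector space $A$ is submultiplicative if $\rho(xy)\le\rho(x)\rho(y)$ for all $x,y\in A$. Let $\eta$ be the finest locally multiplicatively convex (lmc) topology on $A$, i.e. the locally convex vector space topology generated by the family of all submultiplicative seminorms on $A$. Then for every $\sum A^{2d}$-module $S$ of $A$, the $\eta$-closure of $S$ equals $\mathrm{Pos}(K_S)$. In particular, the $\eta$-closure of $\sum A^{2d}$ equals $\mathrm{Pos}(V_A)$, the set of elements of $A$ that are nonnegative under every unital $\mathbb{R}$-algebra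 homomorphism $A\to\mathbb{R}$. -/

import Mathlib

open scoped Topology Pointwise

/-- `S` is a `∑ A^{2d}`-module of `A`: `1 ∈ S`, `S + S ⊆ S`, and `a^{2d} • S ⊆ S` for all `a`. -/
structure IsPowModule {A : Type*} [CommRing A] (d : ℕ) (S : Set A) : Prop where
  one_mem : (1 : A) ∈ S
  add_mem : ∀ x ∈ S, ∀ y ∈ S, x + y ∈ S
  pow_mul_mem : ∀ a : A, ∀ x ∈ S, a ^ (2 * d) * x ∈ S

/-- `∑ A^{2d}`: the set of all finite sums of `2d`-th powers of elements of `A`. -/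
def sumPow (A : Type*) [CommRing A] (d : ℕ) : Set A :=
  {x | ∃ l : List A, x = (l.map fun a => a ^ (2 * d)).sum}

/-- The nonnegativity set `K_S` of `S`, a subset of the set `V_A` of all unital
`ℝ`-algebra homomorphisms `A → ℝ`. -/
def nonnegSet {A : Type*} [CommRing A] [Algebra ℝ A] (S : Set A) : Set (A →ₐ[ℝ] ℝ) :=
  {α | ∀ a ∈ S, 0 ≤ α a}

/-- `Pos(K)`: the elements of `A` that are nonnegative at every character in `K`. -/
def posSet {A : Type*} [CommRing A] [Algebra ℝ A] (K : Set (A →ₐ[ℝ] ℝ)) : Set A :=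
  {a | ∀ α ∈ K, 0 ≤ α a}

/-- The submultiplicative seminorms on the `ℝ`-algebra `A` (no condition on the value at `1`). -/
abbrev SubmulSeminorm (A : Type*) [CommRing A] [Algebra ℝ A] : Type _ :=
  {p : Seminorm ℝ A // ∀ x y : A, p (x * y) ≤ p x * p y}

instance (A : Type*) [CommRing A] [Algebra ℝ A] : Nonempty (SubmulSeminorm A) :=
  ⟨⟨0, fun x y => by simp⟩⟩

/-- The family of all submultiplicative seminorms on `A`, indexed by itself. -/
noncomputable def submulFamily (A : Type*) [CommRing A] [Algebra ℝ A] :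
    SeminormFamily ℝ A (SubmulSeminorm A) := fun p => p.1

/-- The finest lmc topology on `A`: the vector space topology generated by the family of all
submultiplicative seminorms. The balls of finite suprema of such seminorms
form a basis of neighbourhoods of `0`. -/
noncomputable abbrev finestLMC (A : Type*) [CommRing A] [Algebra ℝ A] : TopologicalSpace A :=
  (submulFamily A).moduleFilterBasis.topology

/-- A topology on `A` is locally multiplicatively convex (lmc) if it is a locally convex vector
space topology with a neighbourhood basis of `0` consisting of sets `U` with `U * U ⊆ U`. -/
structure IsLMC {A : Type*} [CommRing A] [Algebra ℝ A] (τ : TopologicalSpace A) : Prop where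
  addGroup : IsTopologicalAddGroup A
  smul : ContinuousSMul ℝ A
  locallyConvex : LocallyConvexSpace ℝ A
  mset : ∀ V ∈ 𝓝 (0 : A), ∃ U ∈ 𝓝 (0 : A), U ⊆ V ∧ ∀ x ∈ U, ∀ y ∈ U, x * y ∈ U

theorem isLMC_finestLMC (A : Type*) [CommRing A] [Algebra ℝ A] : IsLMC (finestLMC A) := by
  let := finestLMC A
  have h : WithSeminorms (submulFamily A) := ⟨rfl⟩
  refine ⟨h.topologicalAddGroup, h.continuousSMul, h.toLocallyConvexSpace, fun V hV => ?_⟩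
  obtain ⟨s, r, hr, hs⟩ := (h.mem_nhds_iff 0 V).1 hV
  have hr' : 0 < min r 1 := lt_min hr one_pos
  refine ⟨(s.sup (submulFamily A)).ball 0 (min r 1), (h.mem_nhds_iff 0 _).2 ⟨s, _, hr', le_rfl⟩,
    (Seminorm.ball_mono (min_le_left _ _)).trans hs, fun x hx y hy => ?_⟩
  rw [Seminorm.ball_finset_sup_eq_iInter _ _ _ hr'] at hx hy ⊢
  simp only [Set.mem_iInter, Seminorm.mem_ball_zero] at hx hy ⊢
  intro i hi
  calc submulFamily A i (x * y) ≤ submulFamily A i x * submulFamily A i y := i.2 x y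
    _ ≤ submulFamily A i x * 1 :=
      mul_le_mul_of_nonneg_left ((hy i hi).le.trans (min_le_right _ _)) (apply_nonneg _ _)
    _ < min r 1 := by rw [mul_one]; exact hx i hi

/-- In Mathlib's order on topologies, `η ≤ τ` means that `η` is finer than `τ`. -/
theorem finestLMC_le {A : Type*} [CommRing A] [Algebra ℝ A] (τ : TopologicalSpace A)
    (hτ : IsLMC τ) : finestLMC A ≤ τ := by
  have hη := isLMC_finestLMC A
  have key : ∀ V ∈ @nhds A τ 0, V ∈ @nhds A (finestLMC A) 0 := by
    intro V hV
    let := τ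
    have := hτ.addGroup
    have := hτ.smul
    have := hτ.locallyConvex
    obtain ⟨W, ⟨hW, hWb, hWc⟩, hWV⟩ := (nhds_hasBasis_absConvex ℝ A).mem_iff.1 hV
    obtain ⟨U, hU, hUW, hUm⟩ := hτ.mset W hW
    let B : Set A := absConvexHull ℝ U
    have hBU : U ⊆ B := subset_absConvexHull
    have hBW : B ⊆ W := absConvexHull_min hUW ⟨hWb, hWc⟩
    have hB : AbsConvex ℝ B := absConvex_absConvexHull
    have hB0 : B ∈ 𝓝 (0 : A) := Filter.mem_of_superset hU hBU
    have hBm : ∀ x ∈ B, ∀ y ∈ B, x * y ∈ B := by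
      have h1 : ∀ x ∈ U, ∀ y ∈ B, x * y ∈ B := by
        intro x hx
        refine absConvexHull_min (t := {y | x * y ∈ B}) (fun y hy => hBU (hUm x hx y hy)) ⟨?_, ?_⟩
        · refine balanced_iff_smul_mem.2 fun {a} ha y hy => ?_
          simpa [mul_smul_comm] using hB.1.smul_mem ha hy
        · exact hB.2.linear_preimage (LinearMap.mulLeft ℝ x)
      intro x hx y hy
      refine absConvexHull_min (t := {x | x * y ∈ B}) (fun x hx => h1 x hx y hy) ⟨?_, ?_⟩ hx
      · refine balanced_iff_smul_mem.2 fun {a} ha y hy => ?_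
        simpa [smul_mul_assoc] using hB.1.smul_mem ha hy
      · exact hB.2.linear_preimage (LinearMap.mulRight ℝ y)
    have hBa : Absorbent ℝ B := absorbent_nhds_zero hB0
    let q : Seminorm ℝ A := gaugeSeminorm hB.1 hB.2 hBa
    have hq : ∀ x y, q (x * y) ≤ q x * q y := by
      intro x y
      refine le_of_forall_gt_imp_ge_of_dense fun c hc => ?_
      have aux : ∀ s t : ℝ, q x < s → q y < t → q (x * y) ≤ s * t := by
        intro s t hs ht
        obtain ⟨a, ha, has, hxa⟩ := exists_lt_of_gauge_lt hBa hs
        obtain ⟨b, hb, hbt, hyb⟩ := exists_lt_of_gauge_lt hBa ht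
        obtain ⟨u, hu, rfl⟩ := hxa
        obtain ⟨v, hv, rfl⟩ := hyb
        have : (a • u) * (b • v) ∈ (a * b) • B :=
          ⟨u * v, hBm u hu v hv, (smul_mul_smul_comm a u b v).symm⟩
        exact (gauge_le_of_mem (mul_pos ha hb).le this).trans
          (mul_le_mul has.le hbt.le hb.le (ha.trans has).le)
      have hcont : Filter.Tendsto (fun e : ℝ => (q x + e) * (q y + e)) (𝓝[>] 0)
          (𝓝 (q x * q y)) := by
        have : Continuous fun e : ℝ => (q x + e) * (q y + e) := by fun_prop
        simpa using (this.tendsto 0).mono_left nhdsWithin_le_nhds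
      refine le_trans (ge_of_tendsto hcont ?_) hc.le
      filter_upwards [self_mem_nhdsWithin] with e he
      have he' : (0 : ℝ) < e := he
      exact aux _ _ (by linarith) (by linarith)
    have hqB : q.ball 0 1 ⊆ B := by
      intro x hx
      rw [Seminorm.mem_ball_zero] at hx
      exact setOfPred_gauge_lt_one_subset_self hB.2 (mem_of_mem_nhds hB0) hBa hx
    let := finestLMC A
    have h : WithSeminorms (submulFamily A) := ⟨rfl⟩
    refine (h.mem_nhds_iff 0 V).2 ⟨{⟨q, hq⟩}, 1, one_pos, ?_⟩
    rw [Finset.sup_singleton (f := submulFamily A) (b := (⟨q, hq⟩ : SubmulSeminorm A))]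
    exact (hqB.trans hBW).trans hWV
  have h1 := hη.addGroup
  have h2 := hτ.addGroup
  rw [← continuous_id_iff_le]
  have h3 := @IsTopologicalAddGroup.toContinuousAdd _ τ _ h2
  exact @continuous_of_continuousAt_zero A (finestLMC A) _ h1 A _ _ τ h3 _ _ (AddMonoidHom.id A) key

/-! Characters are `η`-continuous because `|α|` is itself a submultiplicative seminorm, so the
closure lies in `Pos(K_S)`. For the converse one submultiplicative seminorm at a time suffices,
since finite suprema stay submultiplicative. Let `T` be the closure of `S` for it, a closed convex
cone. By the inverse function theorem in the completion, elements near `1` are limits of `2d`-th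
powers, so multiplication by `1 ± c x` preserves `T` for small `c > 0`. This bounds the states of
`T` pointwise and forces extreme states to be multiplicative. By Krein–Milman, an element
nonnegative at the characters in `K_T` is nonnegative at every state; Hahn–Banach separation then
puts it in `T`. -/

/-- In a complete normed commutative real algebra, every element near `1` is an `n`-th power. -/
theorem eventually_exists_pow_eq {B : Type*} [NormedCommRing B] [NormedAlgebra ℝ B]
    [CompleteSpace B] {n : ℕ} (hn : n ≠ 0) : ∀ᶠ b in 𝓝 (1 : B), ∃ z : B, z ^ n = b := by
  have hn' : (n : ℝ) ≠ 0 := Nat.cast_ne_zero.2 hn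
  -- The derivative of `x ^ n` at `1` is multiplication by `n`, which is invertible, so the image of
  -- a neighbourhood of `1` is a neighbourhood of `1`.
  have h := hasStrictFDerivAt_pow (𝕜 := ℝ) n (x := (1 : B))
  let e : B ≃L[ℝ] B := ContinuousLinearEquiv.smulLeft (Units.mk0 (n : ℝ) hn')
  have he : HasStrictFDerivAt (fun x : B => x ^ n) (e : B →L[ℝ] B) 1 := by
    refine h.congr_fderiv ?_
    ext x
    simp [e, Units.smul_def, Nat.cast_smul_eq_nsmul]
  have h1 := he.map_nhds_eq_of_equiv
  rw [one_pow] at h1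
  rw [← h1, Filter.eventually_map]
  exact Filter.Eventually.of_forall fun x => ⟨x, rfl⟩

/-- In a seminormed commutative real algebra, every element near `1` is a limit of `n`-th powers. -/
theorem exists_one_add_mem_closure_range_pow (A : Type*) [SeminormedCommRing A]
    [NormedAlgebra ℝ A] {n : ℕ} (hn : n ≠ 0) :
    ∃ δ > 0, ∀ x : A, ‖x‖ < δ → 1 + x ∈ closure (Set.range fun y : A => y ^ n) := by
  obtain ⟨δ, hδ, h⟩ := Metric.eventually_nhds_iff.1
    (eventually_exists_pow_eq (B := UniformSpace.Completion A) hn)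
  refine ⟨δ, hδ, fun x hx => Metric.mem_closure_range_iff.2 fun ε hε => ?_⟩
  obtain ⟨z, hz⟩ := h (y := ((1 + x : A) : UniformSpace.Completion A)) (by
    rw [← UniformSpace.Completion.coe_one, UniformSpace.Completion.dist_eq]
    simpa [dist_eq_norm] using hx)
  have hc : Continuous fun w : UniformSpace.Completion A =>
      dist (((1 + x : A) : UniformSpace.Completion A)) (w ^ n) := by fun_prop
  -- The root `z` may lie outside `A`; density of `A` in the completion replaces it by some `y` in
  -- `A` with `y ^ n` still within `ε`.
  have ho : IsOpen {w : UniformSpace.Completion A |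
      dist (((1 + x : A) : UniformSpace.Completion A)) (w ^ n) < ε} :=
    isOpen_lt hc continuous_const
  obtain ⟨_, hw, y, rfl⟩ := UniformSpace.Completion.denseRange_coe.inter_open_nonempty _ ho
    ⟨z, by simpa [hz] using hε⟩
  refine ⟨y, ?_⟩
  have hp : ((y ^ n : A) : UniformSpace.Completion A) = (y : UniformSpace.Completion A) ^ n :=
    map_pow UniformSpace.Completion.coeRingHom y n
  rwa [Set.mem_ofPred_eq, ← hp, UniformSpace.Completion.dist_eq] at hw

/-! ### States and their extreme points -/

/-- The normalized real-linear functionals nonnegative on `T`, as a set of functions. -/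
def stateSet {A : Type*} [CommRing A] [Algebra ℝ A] (T : Set A) : Set (A → ℝ) :=
  {L | (∀ x y, L (x + y) = L x + L y) ∧ (∀ (r : ℝ) x, L (r • x) = r * L x) ∧ L 1 = 1 ∧
    ∀ t ∈ T, 0 ≤ L t}

section

variable {A : Type*} [CommRing A] [Algebra ℝ A] {T : Set A}

theorem convex_stateSet : Convex ℝ (stateSet T) := by
  rintro L ⟨h1, h2, h3, h4⟩ M ⟨k1, k2, k3, k4⟩ a b ha hb hab
  refine ⟨fun x y => ?_, fun r x => ?_, ?_, fun t ht => ?_⟩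
  · simp only [Pi.add_apply, Pi.smul_apply, smul_eq_mul, h1, k1]; ring
  · simp only [Pi.add_apply, Pi.smul_apply, smul_eq_mul, h2, k2]; ring
  · simp [h3, k3, hab]
  · have := h4 t ht
    have := k4 t ht
    simp only [Pi.add_apply, Pi.smul_apply, smul_eq_mul]
    positivity

theorem isClosed_stateSet : IsClosed (stateSet T) := by
  simp only [stateSet, Set.ofPred_and, Set.ofPred_forall]
  refine .inter ?_ (.inter ?_ (.inter ?_ ?_))
  · exact isClosed_iInter fun x => isClosed_iInter fun y =>
      isClosed_eq (by fun_prop) (by fun_prop)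
  · exact isClosed_iInter fun x => isClosed_iInter fun y =>
      isClosed_eq (by fun_prop) (by fun_prop)
  · exact isClosed_eq (by fun_prop) (by fun_prop)
  · exact isClosed_iInter fun x => isClosed_iInter fun y =>
      isClosed_le (by fun_prop) (by fun_prop)

/-- Nonnegativity at `1 ± c x` forces `|L x| ≤ 1 / c`, so the states form a closed subset of a
product of compact intervals (Tychonoff). -/
theorem isCompact_stateSet (hT : ∀ x : A, ∃ c : ℝ, 0 < c ∧ 1 + c • x ∈ T ∧ 1 - c • x ∈ T) :
    IsCompact (stateSet T) := by
  choose c hc hp hm using hT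
  refine (isCompact_univ_pi fun x => isCompact_Icc (a := -(c x)⁻¹) (b := (c x)⁻¹)).of_isClosed_subset
    isClosed_stateSet ?_
  rintro L ⟨h1, h2, h3, h4⟩ x -
  have hx := h4 _ (hp x)
  have hy := h4 _ (hm x)
  have hs : L (1 - c x • x) = 1 - c x * L x := by
    rw [sub_eq_add_neg, h1, h3, ← neg_smul, h2]; ring
  rw [h1, h3, h2] at hx
  rw [hs] at hy
  have hcx := hc x
  constructor
  · rw [neg_le, ← mul_le_mul_iff_right₀ hcx, mul_inv_cancel₀ hcx.ne']; linarith
  · rw [← mul_le_mul_iff_right₀ hcx, mul_inv_cancel₀ hcx.ne']; linarith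

/-- An extreme state of a set stable under multiplication by `1 ± c x` is multiplicative. -/
theorem map_mul_of_mem_extremePoints (h1T : (1 : A) ∈ T)
    (hT : ∀ x : A, ∃ c : ℝ, 0 < c ∧ ∀ t ∈ T, (1 + c • x) * t ∈ T ∧ (1 - c • x) * t ∈ T)
    {L : A → ℝ} (hL : L ∈ (stateSet T).extremePoints ℝ) (x y : A) : L (x * y) = L x * L y := by
  obtain ⟨⟨ha, hs, h1, hp⟩, hext⟩ := hL
  obtain ⟨c₀, hc₀, hc₀T⟩ := hT x
  have hneg : ∀ z, L (-z) = -L z := fun z => by simpa using hs (-1) z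
  have hsub : ∀ z w, L (z - w) = L z - L w := fun z w => by
    rw [sub_eq_add_neg, ha, hneg, sub_eq_add_neg]
  have hb₁ := hp _ (hc₀T 1 h1T).1
  have hb₂ := hp _ (hc₀T 1 h1T).2
  rw [mul_one, ha, h1, hs] at hb₁
  rw [mul_one, hsub, h1, hs] at hb₂
  -- halving the scale makes `L (1 ± c x)` strictly positive
  set c := c₀ / 2 with hc
  have hcp : 0 < c := by positivity
  have hu : 0 < 1 + c * L x := by rw [hc]; linarith
  have hv : 0 < 1 - c * L x := by rw [hc]; linarith
  have hposu : ∀ t ∈ T, 0 ≤ L t + c * L (x * t) := fun t ht => by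
    have h := hp _ (hc₀T t ht).1
    rw [add_mul, one_mul, smul_mul_assoc, ha, hs] at h
    have := hp t ht
    rw [hc]; linarith
  have hposv : ∀ t ∈ T, 0 ≤ L t - c * L (x * t) := fun t ht => by
    have h := hp _ (hc₀T t ht).2
    rw [sub_mul, one_mul, smul_mul_assoc, hsub, hs] at h
    have := hp t ht
    rw [hc]; linarith
  -- `L` is the convex combination of the states `U` and `V` with weights `(1 ± c * L x) / 2`.
  -- Extremality gives `U = L`, which at `y` reads `L (x * y) = L x * L y`.
  let U : A → ℝ := fun t => (L t + c * L (x * t)) / (1 + c * L x)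
  let V : A → ℝ := fun t => (L t - c * L (x * t)) / (1 - c * L x)
  have hU : U ∈ stateSet T := by
    refine ⟨fun z w => ?_, fun r z => ?_, ?_, fun t ht => div_nonneg (hposu t ht) hu.le⟩
    · simp only [U, mul_add, ha]; ring
    · simp only [U, mul_smul_comm, hs]; ring
    · simp only [U, mul_one, h1]; exact div_self hu.ne'
  have hV : V ∈ stateSet T := by
    refine ⟨fun z w => ?_, fun r z => ?_, ?_, fun t ht => div_nonneg (hposv t ht) hv.le⟩
    · simp only [V, mul_add, ha]; ring
    · simp only [V, mul_smul_comm, hs]; ring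
    · simp only [V, mul_one, h1]; exact div_self hv.ne'
  have hUL : U = L := by
    refine hext hU hV ⟨(1 + c * L x) / 2, (1 - c * L x) / 2, by positivity, by positivity,
      by ring, ?_⟩
    ext t
    simp only [Pi.add_apply, Pi.smul_apply, smul_eq_mul, U, V]
    field_simp
    ring
  have h := congrFun hUL y
  simp only [U] at h
  rw [div_eq_iff hu.ne'] at h
  have : c * L (x * y) = c * (L x * L y) := by linear_combination h
  exact mul_left_cancel₀ hcp.ne' this

/-- An element nonnegative at all characters in `nonnegSet T` is nonnegative at all states. -/
theorem apply_nonneg_of_mem_stateSet (h1T : (1 : A) ∈ T)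
    (hT : ∀ x : A, ∃ c : ℝ, 0 < c ∧ ∀ t ∈ T, (1 + c • x) * t ∈ T ∧ (1 - c • x) * t ∈ T)
    {a : A} (ha : a ∈ posSet (nonnegSet T)) {L : A → ℝ} (hL : L ∈ stateSet T) : 0 ≤ L a := by
  have hcomp : IsCompact (stateSet T) := isCompact_stateSet fun x => by
    obtain ⟨c, hc, h⟩ := hT x
    exact ⟨c, hc, by simpa using (h 1 h1T).1, by simpa using (h 1 h1T).2⟩
  -- Krein–Milman: nonnegativity at `a` is a closed convex condition on states, so it need only be
  -- checked at extreme ones.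
  rw [← closure_convexHull_extremePoints hcomp convex_stateSet] at hL
  have hclosed : IsClosed {M : A → ℝ | 0 ≤ M a} := isClosed_le (by fun_prop) (by fun_prop)
  have hconv : Convex ℝ {M : A → ℝ | 0 ≤ M a} :=
    (convex_Ici (0 : ℝ)).linear_preimage (LinearMap.proj (φ := fun _ : A => ℝ) a)
  refine closure_minimal (convexHull_min (fun M hM => ?_) hconv) hclosed hL
  have hmul := map_mul_of_mem_extremePoints h1T hT hM
  obtain ⟨⟨hadd, hsmul, hone, hpos⟩, -⟩ := hM
  let l : A →ₗ[ℝ] ℝ := { toFun := M, map_add' := hadd, map_smul' := hsmul }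
  exact ha (AlgHom.ofLinearMap l hone hmul) hpos

end

/-! ### Power modules in a seminormed algebra -/

theorem IsPowModule.zero_mem {A : Type*} [CommRing A] {d : ℕ} (hd : 1 ≤ d) {S : Set A}
    (hS : IsPowModule d S) : (0 : A) ∈ S := by
  simpa [show d ≠ 0 by omega] using hS.pow_mul_mem 0 1 hS.one_mem

/-- A nonnegative real is the `2d`-th power of its real `2d`-th root, so a power module is a convex
cone. -/
theorem IsPowModule.smul_mem {A : Type*} [CommRing A] [Algebra ℝ A] {d : ℕ} (hd : 1 ≤ d)
    {S : Set A} (hS : IsPowModule d S) {r : ℝ} (hr : 0 ≤ r) {x : A} (hx : x ∈ S) : r • x ∈ S := by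
  have h := hS.pow_mul_mem (algebraMap ℝ A (r ^ (((2 * d : ℕ) : ℝ)⁻¹))) x hx
  rwa [← map_pow, Real.rpow_inv_natCast_pow hr (by omega), ← Algebra.smul_def] at h

theorem IsPowModule.closure {A : Type*} [SeminormedCommRing A] {d : ℕ} {S : Set A}
    (hS : IsPowModule d S) : IsPowModule d (closure S) where
  one_mem := subset_closure hS.one_mem
  add_mem _ hx _ hy := map_mem_closure₂ continuous_add hx hy hS.add_mem
  pow_mul_mem a _ hx := map_mem_closure (continuous_const_mul (a ^ (2 * d))) hx (hS.pow_mul_mem a)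

/-- In a seminormed commutative real algebra, the closure of a `∑ A^{2d}`-module `S` contains every
element that is nonnegative on `nonnegSet S`. -/
theorem IsPowModule.posSet_nonnegSet_subset_closure {A : Type*} [SeminormedCommRing A]
    [NormedAlgebra ℝ A] {d : ℕ} (hd : 1 ≤ d) {S : Set A} (hS : IsPowModule d S) :
    posSet (nonnegSet S) ⊆ _root_.closure S := by
  intro a ha
  have hC := hS.closure
  have hclosed : IsClosed (_root_.closure S) := isClosed_closure
  -- Enlarging `S` only shrinks its nonnegativity set, so no continuity of characters is needed
  -- here.
  replace ha : a ∈ posSet (nonnegSet (_root_.closure S)) :=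
    fun α hα => ha α fun s hs => hα s (subset_closure hs)
  generalize _root_.closure S = T at hC hclosed ha ⊢
  obtain ⟨δ, hδ, hroot⟩ := exists_one_add_mem_closure_range_pow A (n := 2 * d) (by omega)
  have hmul : ∀ x : A, ‖x‖ < δ → ∀ t ∈ T, (1 + x) * t ∈ T := fun x hx t ht => by
    rw [← hclosed.closure_eq]
    refine map_mem_closure (f := (· * t)) (continuous_mul_const t) (hroot x hx) ?_
    rintro _ ⟨y, rfl⟩
    exact hC.pow_mul_mem y t ht
  have hT : ∀ x : A, ∃ c : ℝ, 0 < c ∧ ∀ t ∈ T, (1 + c • x) * t ∈ T ∧ (1 - c • x) * t ∈ T := by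
    intro x
    -- The `+ 1` keeps the scale `δ / (‖x‖ + 1)` meaningful when `‖x‖ = 0` and makes the bound by
    -- `δ` strict.
    have hx : 0 < ‖x‖ + 1 := by positivity
    have hc : 0 < δ / (‖x‖ + 1) := by positivity
    have hn : ‖(δ / (‖x‖ + 1)) • x‖ < δ := by
      refine (norm_smul_le _ _).trans_lt ?_
      rw [Real.norm_of_nonneg hc.le, div_mul_eq_mul_div, div_lt_iff₀ hx]
      exact mul_lt_mul_of_pos_left (lt_add_one _) hδ
    refine ⟨_, hc, fun t ht => ⟨hmul _ hn t ht, ?_⟩⟩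
    rw [sub_eq_add_neg]
    exact hmul _ (by rwa [norm_neg]) t ht
  by_contra haT
  let C : ProperCone ℝ A :=
    { carrier := T
      add_mem' := fun hx hy => hC.add_mem _ hx _ hy
      zero_mem' := hC.zero_mem hd
      smul_mem' := fun r _ hx => hC.smul_mem hd r.2 hx
      isClosed' := hclosed }
  obtain ⟨f, hf, hfa⟩ := C.hyperplane_separation_point (x₀ := a) haT
  have hfT : ∀ t ∈ T, 0 ≤ f t := hf
  -- If `f 1 = 0`, then `1 + c • a ∈ T` gives `0 ≤ c * f a`, against `f a < 0`. Hence `f` can be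
  -- normalized to a state.
  have h0 : f 1 ≠ 0 := fun h0 => by
    obtain ⟨c, hc, h⟩ := hT a
    have := hfT _ (h 1 hC.one_mem).1
    simp only [mul_one, map_add, h0, zero_add, map_smul, smul_eq_mul] at this
    exact hfa.not_ge (nonneg_of_mul_nonneg_right this hc)
  have h1 : 0 < f 1 := (hfT 1 hC.one_mem).lt_of_ne' h0
  have hL : (fun x => f x / f 1) ∈ stateSet T :=
    ⟨fun x y => by simp [add_div], fun r x => by simp [mul_div_assoc], div_self h0,
      fun t ht => div_nonneg (hfT t ht) h1.le⟩
  have := apply_nonneg_of_mem_stateSet hC.one_mem hT ha hL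
  exact (div_neg_of_neg_of_pos hfa h1).not_ge this

/-! ### Passage to the finest lmc topology -/

/-- The seminormed ring structure defined by a submultiplicative seminorm. -/
abbrev SubmulSeminorm.seminormedCommRing {A : Type*} [CommRing A] [Algebra ℝ A]
    (p : SubmulSeminorm A) : SeminormedCommRing A :=
  { ‹CommRing A›, p.1.toAddGroupSeminorm.toSeminormedAddCommGroup with
    norm_mul_le := p.2 }

theorem IsPowModule.exists_sub_lt {A : Type*} [CommRing A] [Algebra ℝ A] {d : ℕ} (hd : 1 ≤ d)
    {S : Set A} (hS : IsPowModule d S) (p : SubmulSeminorm A) {a : A}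
    (ha : a ∈ posSet (nonnegSet S)) {r : ℝ} (hr : 0 < r) : ∃ s ∈ S, p.1 (s - a) < r := by
  let := p.seminormedCommRing
  let : NormedAlgebra ℝ A := { ‹Algebra ℝ A› with norm_smul_le := fun c x =>
    (map_smul_eq_mul p.1 c x).le }
  obtain ⟨s, hs, h⟩ := Metric.mem_closure_iff.1 (hS.posSet_nonnegSet_subset_closure hd ha) r hr
  rw [dist_comm, dist_eq_norm] at h
  exact ⟨s, hs, h⟩

/-- Finite suprema of submultiplicative seminorms are submultiplicative. -/
theorem finset_sup_submulFamily_mul_le {A : Type*} [CommRing A] [Algebra ℝ A]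
    (s : Finset (SubmulSeminorm A)) (x y : A) :
    s.sup (submulFamily A) (x * y) ≤ s.sup (submulFamily A) x * s.sup (submulFamily A) y :=
  Seminorm.finset_sup_apply_le (mul_nonneg (apply_nonneg _ _) (apply_nonneg _ _)) fun i hi =>
    (i.2 x y).trans (mul_le_mul (Seminorm.le_finset_sup_apply hi) (Seminorm.le_finset_sup_apply hi)
      (apply_nonneg _ _) (apply_nonneg _ _))

/-- Characters are continuous for the finest lmc topology. -/
theorem continuous_algHom_finestLMC {A : Type*} [CommRing A] [Algebra ℝ A] (α : A →ₐ[ℝ] ℝ) :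
    @Continuous A ℝ (finestLMC A) _ α := by
  let := finestLMC A
  have h : WithSeminorms (submulFamily A) := ⟨rfl⟩
  -- `|α|` belongs to the family defining the topology, and its continuity at `0` gives that of `α`.
  let q : SubmulSeminorm A :=
    ⟨(normSeminorm ℝ ℝ).comp α.toLinearMap, fun x y => by simp⟩
  have hq : Continuous (q.1 : A → ℝ) := h.continuous_seminorm q
  have := h.topologicalAddGroup
  refine continuous_of_continuousAt_zero α.toLinearMap.toAddMonoidHom ?_
  have h0 := hq.tendsto 0
  rw [map_zero] at h0
  rw [ContinuousAt, map_zero]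
  exact tendsto_zero_iff_norm_tendsto_zero.2 h0

theorem isPowModule_sumPow (A : Type*) [CommRing A] (d : ℕ) : IsPowModule d (sumPow A d) where
  one_mem := ⟨[1], by simp⟩
  add_mem := by
    rintro _ ⟨l, rfl⟩ _ ⟨m, rfl⟩
    exact ⟨l ++ m, by simp⟩
  pow_mul_mem := by
    rintro a _ ⟨l, rfl⟩
    exact ⟨l.map (a * ·), by simp [mul_pow, List.sum_map_mul_left, Function.comp_def]⟩

theorem nonnegSet_sumPow (A : Type*) [CommRing A] [Algebra ℝ A] (d : ℕ) :
    nonnegSet (sumPow A d) = Set.univ := by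
  refine Set.eq_univ_of_forall fun α => ?_
  rintro _ ⟨l, rfl⟩
  rw [map_list_sum]
  refine List.sum_nonneg fun x hx => ?_
  simp only [List.map_map, List.mem_map, Function.comp_apply, map_pow] at hx
  obtain ⟨y, -, rfl⟩ := hx
  exact (even_two_mul d).pow_nonneg _

theorem IsPowModule.closure_finestLMC {A : Type*} [CommRing A] [Algebra ℝ A] {d : ℕ} (hd : 1 ≤ d)
    {S : Set A} (hS : IsPowModule d S) : @_root_.closure A (finestLMC A) S = posSet (nonnegSet S) := by
  let := finestLMC A
  have h : WithSeminorms (submulFamily A) := ⟨rfl⟩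
  refine Set.Subset.antisymm (fun a ha α hα => ?_) fun a ha => ?_
  · exact closure_minimal (t := {x | 0 ≤ α x}) hα
      (isClosed_le continuous_const (continuous_algHom_finestLMC α)) ha
  -- A basic neighbourhood is a ball of a finite supremum, which is again a single submultiplicative
  -- seminorm.
  · refine mem_closure_iff_nhds.2 fun V hV => ?_
    obtain ⟨s, r, hr, hV⟩ := (h.mem_nhds_iff a V).1 hV
    obtain ⟨b, hb, hba⟩ := hS.exists_sub_lt hd ⟨_, finset_sup_submulFamily_mul_le s⟩ ha hr
    exact ⟨b, hV ((Seminorm.mem_ball _).2 hba), hb⟩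

theorem corollary5p6 {A : Type*} [CommRing A] [Algebra ℝ A] (d : ℕ) (hd : 1 ≤ d) :
    (∀ S : Set A, IsPowModule d S → @closure A (finestLMC A) S = posSet (nonnegSet S)) ∧
      @closure A (finestLMC A) (sumPow A d) = posSet (Set.univ : Set (A →ₐ[ℝ] ℝ)) := by
  refine ⟨fun S hS => hS.closure_finestLMC hd, ?_⟩
  rw [← nonnegSet_sumPow A d]
  exact (isPowModule_sumPow A d).closure_finestLMC hd
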